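/- Fix a principal ideal domain \(R\). A precubical set is a graded set \(P=(P_n)_{n\ge 0}\) with face operators \(d_i^k\colon P_n\to P_{n-1}\) (\(n>0\), \(k\in\{0,1\}\), \(1\le i\le n\)) such that \(d_i^k d_j^l=d_{j-1}^l d_i^k\) for \(i<j\). A higher-dimensional automaton (HDA) is a tuple \(\mathcal A=(P_{\mathcal A},I_{\mathcal A},F_{\mathcal A},\Sigma_{\mathcal A},D_{\mathcal A},\lambda_{\mathcal A})\) consisting of a precubical set \(P_{\mathcal A}\), an initial state \(I_{\mathcal A}\in (P_{\mathcal A})_0\), a set \(F_{\mathcal A}\subseteq (P_{\mathcal A})_0\) of final states, a set \(\Sigma_{\mathcal A}\) with a reflexive and symmetric relation \(D_{\mathcal A}\), and a labeling function \(\lambda_{\mathcal A}\colon (P_{\mathcal A})_1\to\Sigma_{\mathcal A}^*\) with values in the free monoid, such that for all \(x\in(P_{\mathcal A})_2\): \(\lambda_{\mathcal A}(d_i^0x)=\lambda_{\mathcal A}(d_i^1x)\) for \(i=1,2\), and for all \((a,b)\in D_{\mathcal A}\), \(a\) does not occur in \(\lambda_{\mathcal A}(d_1^0x)\) or \(b\)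 does not occur in \(\lambda_{\mathcal A}(d_2^0x)\). The cubical chain complex \(C_*(P)\) has \(C_n(P)\) free on \(P_n\) and \(dx=\sum_{i=1}^n(-1)^i(d_i^0x-d_i^1x)\); its homology is \(H_*(P)\). For \(x\in P_n\), \(n>0\), let \(e_ix=d_1^0\cdots d_{i-1}^0d_{i+1}^0\cdots d_n^0x\in P_1\) (\(e_1x=x\) if \(n=1\)). Let \(\Lambda(\Sigma)\) be the exterior algebra on the free \(R\)-module on \(\Sigma\), graded by the exterior powers. For a word \(m\), let \(|m|\) be its length and \(m_1,\dots,m_{|m|}\) its letters. The labeling chain map \(\mathfrak l_{\mathcal A}\colon C_*(P_{\mathcal A})\to\Lambda(\Sigma_{\mathcal A})\) (zero differential on the target) is given by \(\mathfrak l_{\mathcal A}(x)=1\) for \(x\in (P_{\mathcal A})_0\) and \[\mathfrak l_{\mathcal A}(x)=\sum_{j_1=1}^{|\lambda_{\mathcal A}(e_1x)|}\cdots\sum_{j_n=1}^{|\lambda_{\mathcal A}(e_nx)|}\lambda_{\mathcal A}(e_1x)_{j_1}\wedge\dots\wedge\lambda_{\mathcal A}(e_nx)_{j_n}\qquad (x\in(P_{\mathcal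 A})_n,\ n>0).\] The homology language \(HL(\mathcal A)\) is the graded submodule of \(\Lambda(\Sigma_{\mathcal A})\) that is the image of the induced map \(\ell_{\mathcal A}\colon H_*(P_{\mathcal A})\to\Lambda(\Sigma_{\mathcal A})\), \([z]\mapsto\mathfrak l_{\mathcal A}(z)\). The tensor product \(\mathcal A\otimes\mathcal B\) is the HDA with \((P_{\mathcal A\otimes\mathcal B})_n=\coprod_{p+q=n}(P_{\mathcal A})_p\times(P_{\mathcal B})_q\), where for \((x,y)\in (P_{\mathcal A})_p\times(P_{\mathcal B})_q\) one has \(d_i^k(x,y)=(d_i^kx,y)\) for \(i\le p\) and \(d_i^k(x,y)=(x,d_{i-p}^ky)\) for \(i>p\); with initial state \((I_{\mathcal A},I_{\mathcal B})\), final states \(F_{\mathcal A}\times F_{\mathcal B}\), alphabet \(\Sigma_{\mathcal A}\amalg\Sigma_{\mathcal B}\), dependence relation \(D_{\mathcal A}\amalg D_{\mathcal B}\), and labels \(\lambda_{\mathcal A\otimes\mathcal B}(x,y)=\lambda_{\mathcal A}(x)\) if \(x\) is an edge and \(y\) a vertex, \(\lambda_{\mathcal A\otimes\mathcal B}(x,y)=\lambda_{\mathcal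 B}(y)\) if \(x\) is a vertex and \(y\) an edge. Proposition. Let \(\mathcal A\) and \(\mathcal B\) be HDAs, and view \(HL(\mathcal A)\) and \(HL(\mathcal B)\) as graded submodules of \(\Lambda(\Sigma_{\mathcal A}\amalg\Sigma_{\mathcal B})\) via the canonical inclusions. Then \[HL(\mathcal A\otimes\mathcal B)=HL(\mathcal A)\wedge HL(\mathcal B),\] the submodule spanned by all products \(a\wedge b\) with \(a\in HL(\mathcal A)\), \(b\in HL(\mathcal B)\). Equivalently, as graded modules, \(HL(\mathcal A\otimes\mathcal B)_n=\sum_{p+q=n}HL(\mathcal A)_p\wedge HL(\mathcal B)_q\) for all \(n\ge 0\). -/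

import Mathlib

universe u v u₁ v₁ u₂ v₂ w

/-- A precubical set: a graded set `(P_n)` with face operators `d^k_i : P_n → P_{n-1}` for `n > 0`,
`k ∈ {0, 1}` (`0` = front, `1` = back) and `1 ≤ i ≤ n`. Directions are numbered from `0` here, so
`d^k_i` is `face k (i - 1)`. -/
structure PrecubicalSet where
  /-- the `n`-cubes -/
  cube : ℕ → Type u
  /-- the face operators -/
  face : {n : ℕ} → Fin 2 → Fin (n + 1) → cube (n + 1) → cube n
  /-- `d^k_i ∘ d^l_j = d^l_{j-1} ∘ d^k_i` for `i < j`; the larger index `j` is `j.succ` here. -/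
  face_face : ∀ {n : ℕ} (k l : Fin 2) (i j : Fin (n + 1)), i ≤ j → ∀ x : cube (n + 2),
    face k i (face l j.succ x) = face l j (face k i.castSucc x)

namespace PrecubicalSet

/-- The face operators, indexed by the dimension of the source instead of that of the target. -/
def face' (P : PrecubicalSet.{u}) : {n : ℕ} → Fin 2 → Fin n → P.cube n → P.cube (n - 1)
  | 0, _, i, _ => i.elim0
  | _ + 1, k, i, x => P.face k i x

/-- The `i`-th starting edge `e_i x = d^0_1 ⋯ d^0_{i-1} d^0_{i+1} ⋯ d^0_n x` of an `n`-cube `x`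
(and `e_1 x = x` if `n = 1`). The operators are applied one by one, from right to left: the first
one is `d^0_n` if `i < n`, and `d^0_{n-1}` if `i = n`. -/
def startEdge (P : PrecubicalSet.{u}) : {n : ℕ} → Fin n → P.cube n → P.cube 1
  | 0, i, _ => i.elim0
  | 1, _, x => x
  | n + 2, i, x =>
      if h : i.val < n + 1 then P.startEdge (n := n + 1) ⟨i.val, h⟩ (P.face 0 (Fin.last (n + 1)) x)
      else P.startEdge (n := n + 1) (Fin.last n) (P.face 0 (Fin.last n).castSucc x)

/-- The `n`-cubes of the tensor product: `(P ⊗ Q)_n = ∐_{p + q = n} P_p × Q_q`. -/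
@[ext]
structure TensorCube (P : PrecubicalSet.{u₁}) (Q : PrecubicalSet.{u₂}) (n : ℕ) where
  /-- dimension of the first component -/
  p : ℕ
  /-- dimension of the second component -/
  q : ℕ
  /-- the dimensions add up -/
  add_eq : p + q = n
  /-- first component -/
  fst : P.cube p
  /-- second component -/
  snd : Q.cube q

/-- `d^k_i (x, y) = (d^k_i x, y)` for `i ≤ p` and `(x, d^k_{i-p} y)` for `p < i ≤ p + q`. -/
def tensorFace (P : PrecubicalSet.{u₁}) (Q : PrecubicalSet.{u₂}) {n : ℕ} (k : Fin 2)
    (i : Fin (n + 1)) (z : TensorCube P Q (n + 1)) : TensorCube P Q n :=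
  if h : i.val < z.p then
    ⟨z.p - 1, z.q, by have := z.add_eq; omega, P.face' k ⟨i.val, h⟩ z.fst, z.snd⟩
  else
    ⟨z.p, z.q - 1, by have := z.add_eq; have := i.isLt; omega, z.fst,
      Q.face' k ⟨i.val - z.p, by have := z.add_eq; have := i.isLt; omega⟩ z.snd⟩

theorem face'_face' (P : PrecubicalSet.{u}) {n : ℕ} (k l : Fin 2) (i j : ℕ) (hij : i < j)
    (hj : j < n) (x : P.cube n) :
    P.face' k ⟨i, by omega⟩ (P.face' l ⟨j, hj⟩ x) =
      P.face' l ⟨j - 1, by omega⟩ (P.face' k ⟨i, by omega⟩ x) := by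
  obtain ⟨m, rfl⟩ : ∃ m, n = m + 2 := ⟨n - 2, by omega⟩
  obtain ⟨j, rfl⟩ : ∃ j', j = j' + 1 := ⟨j - 1, by omega⟩
  exact P.face_face k l ⟨i, by omega⟩ ⟨j, by omega⟩ (Fin.mk_le_mk.2 (by omega)) x

theorem tensorFace_of_lt {P : PrecubicalSet.{u₁}} {Q : PrecubicalSet.{u₂}} {n : ℕ} (k : Fin 2)
    (i : ℕ) (hi : i < n + 1) {p q : ℕ} (h : p + q = n + 1) (x : P.cube p) (y : Q.cube q)
    (hip : i < p) :
    tensorFace P Q k ⟨i, hi⟩ ⟨p, q, h, x, y⟩ =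
      ⟨p - 1, q, by omega, P.face' k ⟨i, hip⟩ x, y⟩ := by
  simp [tensorFace, hip]

theorem tensorFace_of_le {P : PrecubicalSet.{u₁}} {Q : PrecubicalSet.{u₂}} {n : ℕ} (k : Fin 2)
    (i : ℕ) (hi : i < n + 1) {p q : ℕ} (h : p + q = n + 1) (x : P.cube p) (y : Q.cube q)
    (hip : p ≤ i) :
    tensorFace P Q k ⟨i, hi⟩ ⟨p, q, h, x, y⟩ =
      ⟨p, q - 1, by omega, x, Q.face' k ⟨i - p, by omega⟩ y⟩ := by
  simp [tensorFace, Nat.not_lt.2 hip]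

/-- The tensor product of precubical sets. -/
def tensor (P : PrecubicalSet.{u₁}) (Q : PrecubicalSet.{u₂}) : PrecubicalSet.{max u₁ u₂} where
  cube := TensorCube P Q
  face := tensorFace P Q
  face_face := by
    rintro n k l ⟨i, hi⟩ ⟨j, hj⟩ hij ⟨p, q, h, x, y⟩
    have hij : i ≤ j := hij
    rw [Fin.succ_mk, Fin.castSucc_mk]
    by_cases h1 : j + 1 < p
    · have h2 : i < p := by omega
      have h3 : i < p - 1 := by omega
      have h4 : j < p - 1 := by omega
      rw [tensorFace_of_lt _ _ _ _ _ _ h1, tensorFace_of_lt _ _ _ _ _ _ h3,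
        tensorFace_of_lt _ _ _ _ _ _ h2, tensorFace_of_lt _ _ _ _ _ _ h4,
        P.face'_face' k l i (j + 1) (by omega) h1 x]
      rfl
    · have h1 : p ≤ j + 1 := by omega
      by_cases h2 : i < p
      · have e : j + 1 - p = j - (p - 1) := by omega
        have h4 : p - 1 ≤ j := by omega
        rw [tensorFace_of_le _ _ _ _ _ _ h1, tensorFace_of_lt _ _ _ _ _ _ h2,
          tensorFace_of_lt _ _ _ _ _ _ h2, tensorFace_of_le _ _ _ _ _ _ h4]
        simp only [e]
      · have e := Q.face'_face' k l (i - p) (j + 1 - p) (by omega) (by omega) y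
        have e' : j + 1 - p - 1 = j - p := by omega
        have h3 : p ≤ i := by omega
        have h4 : p ≤ j := by omega
        simp only [e'] at e
        rw [tensorFace_of_le _ _ _ _ _ _ h1, tensorFace_of_le _ _ _ _ _ _ h3,
          tensorFace_of_le _ _ _ _ _ _ h3, tensorFace_of_le _ _ _ _ _ _ h4, e]

section Subquotient

variable {R : Type w} [CommRing R] {M : Type u} [AddCommGroup M] [Module R M]

/-- The quotient `Z / B` of a submodule `Z` by a submodule `B` (to be used with `B ≤ Z`). -/
def Subquotient (Z B : Submodule R M) : Type u := Z ⧸ B.submoduleOf Z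

noncomputable instance (Z B : Submodule R M) : AddCommGroup (Subquotient Z B) :=
  inferInstanceAs (AddCommGroup (Z ⧸ B.submoduleOf Z))

noncomputable instance (Z B : Submodule R M) : Module R (Subquotient Z B) :=
  inferInstanceAs (Module R (Z ⧸ B.submoduleOf Z))

/-- The class `[z]` of an element `z ∈ Z`. -/
def Subquotient.mk (Z B : Submodule R M) : Z →ₗ[R] Subquotient Z B := (B.submoduleOf Z).mkQ

/-- The linear map `Z / B → N`, `[z] ↦ f z` induced by a linear map `f` that vanishes on `B`. -/
def Subquotient.lift {N : Type v} [AddCommGroup N] [Module R N] (Z B : Submodule R M)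
    (f : M →ₗ[R] N) (hf : B ≤ LinearMap.ker f) : Subquotient Z B →ₗ[R] N :=
  (B.submoduleOf Z).liftQ (f ∘ₗ Z.subtype) fun _ hz => hf hz

theorem Subquotient.lift_mk {N : Type v} [AddCommGroup N] [Module R N] (Z B : Submodule R M)
    (f : M →ₗ[R] N) (hf : B ≤ LinearMap.ker f) (z : Z) :
    Subquotient.lift Z B f hf (Subquotient.mk Z B z) = f z := rfl

theorem Subquotient.mk_surjective (Z B : Submodule R M) :
    Function.Surjective (Subquotient.mk Z B) := Submodule.mkQ_surjective _

end Subquotient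

section Homology

variable (R : Type w) [CommRing R] (P : PrecubicalSet.{u})

/-- Cubical chains: `C_n(P)` is the free module generated by `P_n`. -/
abbrev Chain (n : ℕ) : Type (max u w) := P.cube n →₀ R

/-- The boundary operator `C_{n+1}(P) → C_n(P)`, `dx = ∑_i (-1)^i (d^0_i x - d^1_i x)`, where the
number of the direction `i : Fin (n + 1)` is `i + 1`. -/
noncomputable def boundary (n : ℕ) : P.Chain R (n + 1) →ₗ[R] P.Chain R n :=
  Finsupp.linearCombination R fun x : P.cube (n + 1) =>
    ∑ i : Fin (n + 1), (-1 : R) ^ (i.val + 1) •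
      (Finsupp.single (P.face 0 i x) (1 : R) - Finsupp.single (P.face 1 i x) (1 : R))

/-- The cycles: `ker (d : C_n → C_{n-1})` for `n ≥ 1`, and all of `C_0` for `n = 0`. -/
noncomputable def cycles : (n : ℕ) → Submodule R (P.Chain R n)
  | 0 => ⊤
  | n + 1 => LinearMap.ker (P.boundary R n)

/-- The boundaries `im (d : C_{n+1} → C_n)`. -/
noncomputable def boundaries (n : ℕ) : Submodule R (P.Chain R n) :=
  LinearMap.range (P.boundary R n)

/-- The terms of the boundary of the boundary of a cube. -/
noncomputable def boundaryTerm {n : ℕ} (x : P.cube (n + 2)) (j : Fin (n + 1)) (i : Fin (n + 2)) :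
    P.Chain R n :=
  Finsupp.single (P.face 0 j (P.face 0 i x)) (1 : R) -
    Finsupp.single (P.face 1 j (P.face 0 i x)) (1 : R) -
    (Finsupp.single (P.face 0 j (P.face 1 i x)) (1 : R) -
    Finsupp.single (P.face 1 j (P.face 1 i x)) (1 : R))

theorem boundary_boundary (n : ℕ) : P.boundary R n ∘ₗ P.boundary R (n + 1) = 0 := by
  ext x : 2
  have hT : ∀ (i j : Fin (n + 1)), i ≤ j →
      P.boundaryTerm R x i j.succ = P.boundaryTerm R x j i.castSucc := by
    intro i j hij
    simp only [boundaryTerm, P.face_face _ _ i j hij]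
    abel
  have h : ∑ i : Fin (n + 2), ∑ j : Fin (n + 1),
      (-1 : R) ^ (i.val + j.val) • P.boundaryTerm R x j i = 0 := by
    rw [← Fintype.sum_prod_type'
      (f := fun (i : Fin (n + 2)) (j : Fin (n + 1)) =>
        (-1 : R) ^ (i.val + j.val) • P.boundaryTerm R x j i)]
    refine Finset.sum_involution (fun a _ => if h : a.2.castSucc < a.1 then
        (a.2.castSucc, a.1.pred (Fin.ne_zero_of_lt h))
      else (a.2.succ, a.1.castPred (Fin.ne_last_of_lt (lt_of_le_of_lt (not_lt.1 h)
        (Fin.castSucc_lt_succ))))) ?_ ?_ ?_ ?_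
    · rintro ⟨i, j⟩ -
      dsimp only
      split_ifs with hlt
      · obtain ⟨i, rfl⟩ := Fin.exists_succ_eq_of_ne_zero (Fin.ne_zero_of_lt hlt)
        have hij : j ≤ i := by rw [Fin.lt_def] at hlt; rw [Fin.le_def]; simp at hlt; omega
        simp only [Fin.pred_succ, hT j i hij, Fin.val_succ, Fin.val_castSucc]
        rw [← add_smul, add_right_comm, pow_succ, add_comm i.val]
        simp
      · obtain ⟨i, rfl⟩ := Fin.exists_castSucc_eq.2 (Fin.ne_last_of_lt (lt_of_le_of_lt
          (not_lt.1 hlt) Fin.castSucc_lt_succ))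
        have hij : i ≤ j := by rw [Fin.lt_def] at hlt; rw [Fin.le_def]; simp at hlt; omega
        simp only [Fin.castPred_castSucc, hT i j hij, Fin.val_succ, Fin.val_castSucc]
        rw [← add_smul, add_right_comm j.val, pow_succ, add_comm i.val]
        simp
    · rintro ⟨i, j⟩ - -
      dsimp only
      split_ifs with hlt <;> intro he <;> have he := congrArg Prod.fst he <;>
        simp [Fin.ext_iff, Fin.lt_def] at he hlt <;> omega
    · intro a _; exact Finset.mem_univ _
    · rintro ⟨i, j⟩ -
      dsimp only
      by_cases hlt : j.castSucc < i
      · have h2 : ¬ (i.pred (Fin.ne_zero_of_lt hlt)).castSucc < j.castSucc := by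
          simp [Fin.lt_def] at hlt ⊢; omega
        simp [hlt, h2]
      · have h2 : (i.castPred (Fin.ne_last_of_lt (lt_of_le_of_lt (not_lt.1 hlt)
            Fin.castSucc_lt_succ))).castSucc < j.succ := by
          simp [Fin.lt_def] at hlt ⊢; omega
        simp [hlt]
        intro hle
        exact absurd h2 (not_lt.2 (by simp [Fin.lt_def, Fin.le_def] at hlt hle ⊢; omega))
  refine Eq.trans ?_ h
  simp only [boundary, LinearMap.comp_apply, Finsupp.lsingle_apply,
    Finsupp.linearCombination_single, one_smul, map_sum, map_smul, map_sub, boundaryTerm]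
  refine Finset.sum_congr rfl fun i _ => ?_
  rw [← Finset.sum_sub_distrib, Finset.smul_sum]
  refine Finset.sum_congr rfl fun j _ => ?_
  rw [← smul_sub, smul_smul]
  congr 1
  ring

theorem boundaries_le_cycles (n : ℕ) : P.boundaries R n ≤ P.cycles R n := by
  obtain _ | n := n
  · exact le_top
  · exact LinearMap.range_le_ker_iff.2 (P.boundary_boundary R n)

/-- Cubical homology `H_n(P)`: cycles modulo boundaries. -/
def Homology (n : ℕ) : Type (max u w) := Subquotient (P.cycles R n) (P.boundaries R n)

noncomputable instance (n : ℕ) : AddCommGroup (P.Homology R n) :=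
  instAddCommGroupSubquotient (P.cycles R n) (P.boundaries R n)

noncomputable instance (n : ℕ) : Module R (P.Homology R n) :=
  instModuleSubquotient (P.cycles R n) (P.boundaries R n)

end Homology

end PrecubicalSet

/-- A concurrent alphabet: a set with a reflexive and symmetric dependence relation. -/
structure ConcurrentAlphabet where
  /-- the letters -/
  letter : Type v
  /-- the dependence relation -/
  dep : letter → letter → Prop
  refl : ∀ a, dep a a
  symm : ∀ a b, dep a b → dep b a

/-- The tensor product of concurrent alphabets: the disjoint union, with the union of the images of
the two dependence relations (letters of different factors are independent). -/
def ConcurrentAlphabet.tensor (S : ConcurrentAlphabet.{v₁}) (T : ConcurrentAlphabet.{v₂}) :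
    ConcurrentAlphabet.{max v₁ v₂} where
  letter := S.letter ⊕ T.letter
  dep := Sum.LiftRel S.dep T.dep
  refl := by
    rintro (a | a)
    · exact .inl (S.refl a)
    · exact .inr (T.refl a)
  symm := by
    rintro _ _ (h | h)
    · exact .inl (S.symm _ _ h)
    · exact .inr (T.symm _ _ h)

/-- A higher-dimensional automaton over a concurrent alphabet. Words are lists of letters. -/
structure HDA where
  /-- the underlying precubical set -/
  cubes : PrecubicalSet.{u}
  /-- the initial state -/
  init : cubes.cube 0
  /-- the final states -/
  final : Set (cubes.cube 0)
  /-- the concurrent alphabet -/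
  alphabet : ConcurrentAlphabet.{v}
  /-- the labeling function -/
  label : cubes.cube 1 → List alphabet.letter
  /-- parallel edges of a square have the same label -/
  label_face : ∀ (x : cubes.cube 2) (i : Fin 2),
    label (cubes.face 0 i x) = label (cubes.face 1 i x)
  /-- dependent letters do not occur in the two directions of a square -/
  label_indep : ∀ (x : cubes.cube 2) (a b : alphabet.letter), alphabet.dep a b →
    a ∉ label (cubes.face 0 0 x) ∨ b ∉ label (cubes.face 0 1 x)

namespace HDA

/-- The labeling function of a tensor product: the label of `x` on `(x, y)` with `x` an edge and `y`
a vertex, the label of `y` on `(x, y)` with `x` a vertex and `y` an edge. -/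
def tensorLabel (A : HDA.{u₁, v₁}) (B : HDA.{u₂, v₂}) :
    PrecubicalSet.TensorCube A.cubes B.cubes 1 → List (A.alphabet.letter ⊕ B.alphabet.letter)
  | ⟨1, 0, _, x, _⟩ => (A.label x).map Sum.inl
  | ⟨0, 1, _, _, y⟩ => (B.label y).map Sum.inr
  | ⟨0, 0, h, _, _⟩ => absurd h (by omega)
  | ⟨0, _ + 2, h, _, _⟩ => absurd h (by omega)
  | ⟨1, _ + 1, h, _, _⟩ => absurd h (by omega)
  | ⟨_ + 2, _, h, _, _⟩ => absurd h (by omega)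

/-- The tensor product of HDAs. -/
def tensor (A : HDA.{u₁, v₁}) (B : HDA.{u₂, v₂}) : HDA.{max u₁ u₂, max v₁ v₂} where
  cubes := A.cubes.tensor B.cubes
  init := ⟨0, 0, rfl, A.init, B.init⟩
  final := {z | ∃ x ∈ A.final, ∃ y ∈ B.final, z = ⟨0, 0, rfl, x, y⟩}
  alphabet := A.alphabet.tensor B.alphabet
  label := tensorLabel A B
  label_face := by
    rintro ⟨p, q, h, x, y⟩ i
    obtain ⟨rfl, rfl⟩ | ⟨rfl, rfl⟩ | ⟨rfl, rfl⟩ :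
        (p = 0 ∧ q = 2) ∨ (p = 1 ∧ q = 1) ∨ (p = 2 ∧ q = 0) := by omega
    · have h0 := B.label_face y i
      fin_cases i <;> exact congrArg (List.map Sum.inr) h0
    · fin_cases i <;> rfl
    · have h0 := A.label_face x i
      fin_cases i <;> exact congrArg (List.map Sum.inl) h0
  label_indep := by
    rintro ⟨p, q, h, x, y⟩ a b hab
    obtain ⟨rfl, rfl⟩ | ⟨rfl, rfl⟩ | ⟨rfl, rfl⟩ :
        (p = 0 ∧ q = 2) ∨ (p = 1 ∧ q = 1) ∨ (p = 2 ∧ q = 0) := by omega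
    · change a ∉ (B.label (B.cubes.face 0 0 y)).map Sum.inr ∨
        b ∉ (B.label (B.cubes.face 0 1 y)).map Sum.inr
      cases hab with
      | inl hab => left; intro hm; obtain ⟨_, _, h'⟩ := List.mem_map.1 hm; cases h'
      | inr hab =>
        exact (B.label_indep y _ _ hab).imp
          (mt (List.mem_map_of_injective Sum.inr_injective).1)
          (mt (List.mem_map_of_injective Sum.inr_injective).1)
    · change a ∉ (B.label y).map Sum.inr ∨ b ∉ (A.label x).map Sum.inl
      cases hab with
      | inl hab => left; intro hm; obtain ⟨_, _, h'⟩ := List.mem_map.1 hm; cases h'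
      | inr hab => right; intro hm; obtain ⟨_, _, h'⟩ := List.mem_map.1 hm; cases h'
    · change a ∉ (A.label (A.cubes.face 0 0 x)).map Sum.inl ∨
        b ∉ (A.label (A.cubes.face 0 1 x)).map Sum.inl
      cases hab with
      | inl hab =>
        exact (A.label_indep x _ _ hab).imp
          (mt (List.mem_map_of_injective Sum.inl_injective).1)
          (mt (List.mem_map_of_injective Sum.inl_injective).1)
      | inr hab => left; intro hm; obtain ⟨_, _, h'⟩ := List.mem_map.1 hm; cases h'

/-- Parallel starting edges of opposite faces of a cube have the same label. -/
theorem label_startEdge_face (A : HDA.{u, v}) : ∀ {n : ℕ} (x : A.cubes.cube (n + 2))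
    (i : Fin (n + 2)) (j : Fin (n + 1)),
    A.label (A.cubes.startEdge j (A.cubes.face 0 i x)) =
      A.label (A.cubes.startEdge j (A.cubes.face 1 i x)) := by
  intro n
  induction n with
  | zero => intro x i j; exact A.label_face x i
  | succ n ih =>
    intro x i j
    have key : ∀ (m : Fin (n + 2)) (j' : Fin (n + 1)),
        A.label (A.cubes.startEdge j' (A.cubes.face 0 m (A.cubes.face 0 i x))) =
          A.label (A.cubes.startEdge j' (A.cubes.face 0 m (A.cubes.face 1 i x))) := by
      intro m j'
      by_cases h : i.val ≤ m.val
      · obtain ⟨i', rfl⟩ : ∃ i' : Fin (n + 2), i = i'.castSucc :=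
          ⟨⟨i.val, by omega⟩, rfl⟩
        have h' : i' ≤ m := h
        rw [← A.cubes.face_face 0 0 i' m h' x, ← A.cubes.face_face 1 0 i' m h' x]
        exact ih _ _ _
      · obtain ⟨i', rfl⟩ : ∃ i' : Fin (n + 2), i = i'.succ :=
          ⟨⟨i.val - 1, by omega⟩, by ext; simp; omega⟩
        have h' : m ≤ i' := by
          rw [Fin.le_def]; simp at h; omega
        rw [A.cubes.face_face 0 0 m i' h' x, A.cubes.face_face 0 1 m i' h' x]
        exact ih _ _ _
    unfold PrecubicalSet.startEdge
    split_ifs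
    · exact key _ _
    · exact key _ _

section HomologyLanguage

variable (R : Type w) [CommRing R] (A : HDA.{u, v})

/-- The exterior algebra `Λ(Σ_A)` on the free module generated by the letters of `A`. Its component
of degree `n` is `⋀[R]^n (A.alphabet.letter →₀ R)`. -/
abbrev Ext : Type (max v w) := ExteriorAlgebra R (A.alphabet.letter →₀ R)

/-- The label of an `n`-cube `x`: the sum over all `j_1, …, j_n` of the elements
`λ(e_1 x)_{j_1} ∧ ⋯ ∧ λ(e_n x)_{j_n}`. For `n = 0` this is the unit, see `coe_cubeLabel_zero`. -/
noncomputable def cubeLabel {n : ℕ} (x : A.cubes.cube n) : ⋀[R]^n (A.alphabet.letter →₀ R) :=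
  ∑ j : (i : Fin n) → Fin (A.label (A.cubes.startEdge i x)).length,
    exteriorPower.ιMulti R n fun i =>
      Finsupp.single ((A.label (A.cubes.startEdge i x)).get (j i)) (1 : R)

theorem coe_cubeLabel_zero (x : A.cubes.cube 0) : (A.cubeLabel R x : A.Ext R) = 1 := by
  simp [cubeLabel]

/-- The labeling chain map `C_n(P_A) → Λ^n(Σ_A)`. -/
noncomputable def labelChain (n : ℕ) :
    A.cubes.Chain R n →ₗ[R] ⋀[R]^n (A.alphabet.letter →₀ R) :=
  Finsupp.linearCombination R fun x => A.cubeLabel R x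

theorem cubeLabel_face {n : ℕ} (x : A.cubes.cube (n + 1)) (i : Fin (n + 1)) :
    A.cubeLabel R (A.cubes.face 0 i x) = A.cubeLabel R (A.cubes.face 1 i x) := by
  have h : (fun j => A.label (A.cubes.startEdge j (A.cubes.face 0 i x))) =
      fun j => A.label (A.cubes.startEdge j (A.cubes.face 1 i x)) := by
    funext j
    obtain _ | n := n
    · exact j.elim0
    · exact A.label_startEdge_face x i j
  exact congrArg (fun m : Fin n → List A.alphabet.letter =>
    ∑ j : (i : Fin n) → Fin (m i).length,
      exteriorPower.ιMulti R n fun i => Finsupp.single ((m i).get (j i)) (1 : R)) h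

/-- The labeling chain map is a chain map (`Λ(Σ_A)` has zero differential). -/
theorem labelChain_boundary (n : ℕ) : A.labelChain R n ∘ₗ A.cubes.boundary R n = 0 := by
  ext x : 2
  simp [labelChain, PrecubicalSet.boundary, cubeLabel_face]

/-- The degree `n` part `H_n(P_A) → Λ^n(Σ_A)`, `[z] ↦ 𝔩(z)`, of the map induced by the labeling
chain map. -/
noncomputable def labelHomology (n : ℕ) :
    A.cubes.Homology R n →ₗ[R] ⋀[R]^n (A.alphabet.letter →₀ R) :=
  PrecubicalSet.Subquotient.lift (A.cubes.cycles R n) (A.cubes.boundaries R n) (A.labelChain R n)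
    (LinearMap.range_le_ker_iff.2 (A.labelChain_boundary R n))

/-- The degree `n` part of the homology language, as a submodule of `Λ(Σ_A)`. -/
noncomputable def homologyLanguageDeg (n : ℕ) : Submodule R (A.Ext R) :=
  (LinearMap.range (A.labelHomology R n)).map (⋀[R]^n (A.alphabet.letter →₀ R)).subtype

open scoped DirectSum in
/-- The labeling `ℓ_A : H_*(P_A) → Λ(Σ_A)` of homology. -/
noncomputable def labeling : (⨁ n, A.cubes.Homology R n) →ₗ[R] A.Ext R :=
  DirectSum.toModule R ℕ (A.Ext R) fun n =>
    (⋀[R]^n (A.alphabet.letter →₀ R)).subtype ∘ₗ A.labelHomology R n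

/-- The homology language `HL(A) = im ℓ_A`. -/
noncomputable def homologyLanguage : Submodule R (A.Ext R) :=
  LinearMap.range (A.labeling R)

end HomologyLanguage

section Inclusions

variable (R : Type w) [CommRing R] (A : HDA.{u₁, v₁}) (B : HDA.{u₂, v₂})

/-- The inclusion `Λ(Σ_A) → Λ(Σ_A ⨿ Σ_B)`. -/
noncomputable def extInl : A.Ext R →ₐ[R] (A.tensor B).Ext R :=
  ExteriorAlgebra.map (Finsupp.lmapDomain R R Sum.inl)

/-- The inclusion `Λ(Σ_B) → Λ(Σ_A ⨿ Σ_B)`. -/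
noncomputable def extInr : B.Ext R →ₐ[R] (A.tensor B).Ext R :=
  ExteriorAlgebra.map (Finsupp.lmapDomain R R Sum.inr)

end Inclusions

end HDA

/-! The labeling is multiplicative: the starting edges of a product cube `(x, y)` carry the labels
of those of `x` followed by those of `y`, so its label is the wedge of the two labels. Since a cross
product of cycles is a cycle, products of elements of the two homology languages lie in the homology
language of the tensor product.

For the converse, the Künneth theorem offers one route: besides cross products there is only a Tor
summand, which is torsion, and the exterior algebra is torsion-free. The argument here is direct and
works on chains. Embed the exterior algebra in `V`, its extension of scalars to the fraction field.
A labeling `f` of chains sends cycles into the submodule `H` given by the homology language. As `V ⧸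
H` is divisible, hence injective over a principal ideal domain, and chain modules are free, there is
a `G` such that `f - G ∘ d` has values in `H` on all chains, not only on cycles
(`LinearMap.exists_sub_comp_mem`).

Correct both labelings, `f` to `f' = f - G ∘ d` and `g` to `g' = g - K ∘ d`. Since `f'` and `g`
vanish on boundaries, the Leibniz rule shows that the pairings of `f, g` and of `f', g'` differ by a
map factoring through the differential, so they agree on cycles (`pairing_sub_comp_differential`).
The corrected pairing visibly has values in the sum of the products of the two languages, and
injectivity of the embedding brings this back to the exterior algebra. -/

/-! ### Divisible modules and correction of maps modulo a differential -/

section Divisible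

/-- A divisible module over a principal ideal ring satisfies Baer's criterion. -/
theorem Module.Baer.of_forall_smul_surjective {R : Type u} [CommRing R] [IsPrincipalIdealRing R]
    [IsDomain R] {V : Type v} [AddCommGroup V] [Module R V]
    (hV : ∀ r : R, r ≠ 0 → ∀ x : V, ∃ y : V, r • y = x) : Module.Baer R V := by
  intro I g
  obtain ⟨a, rfl⟩ := (IsPrincipalIdealRing.principal I).principal
  by_cases ha : a = 0
  · subst ha
    refine ⟨0, fun x hx => ?_⟩
    obtain rfl : x = 0 := by simpa using hx
    exact (map_zero g).symm
  -- Dividing the value of `g` at the generator by `a` gives the image of `1` under the extension.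
  · obtain ⟨y, hy⟩ := hV a ha (g ⟨a, Submodule.mem_span_singleton_self a⟩)
    refine ⟨LinearMap.toSpanSingleton R V y, fun x hx => ?_⟩
    obtain ⟨b, rfl⟩ := Submodule.mem_span_singleton.1 hx
    rw [LinearMap.toSpanSingleton_apply, smul_assoc, hy, ← map_smul]
    rfl

/-- If `f` maps the kernel of `d : C → C'` into a submodule `H` of a divisible module and `C'` is
projective, then `f` can be corrected by a map that factors through `d` to take values in `H`. -/
theorem LinearMap.exists_sub_comp_mem {R : Type u} [CommRing R] [IsPrincipalIdealRing R]
    [IsDomain R] {V : Type v} [AddCommGroup V] [Module R V]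
    (hV : ∀ r : R, r ≠ 0 → ∀ x : V, ∃ y : V, r • y = x)
    {C : Type u₁} {C' : Type u₂} [AddCommGroup C] [Module R C] [AddCommGroup C'] [Module R C']
    [Module.Projective R C'] (d : C →ₗ[R] C') (f : C →ₗ[R] V) (H : Submodule R V)
    (hf : ∀ c, d c = 0 → f c ∈ H) :
    ∃ G : C' →ₗ[R] V, ∀ c, f c - G (d c) ∈ H := by
  -- Divisibility passes to quotients, so `V ⧸ H` is injective whatever `H` is.
  have hQ : Module.Baer R (V ⧸ H) := by
    refine .of_forall_smul_surjective fun r hr x => ?_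
    obtain ⟨x, rfl⟩ := H.mkQ_surjective x
    obtain ⟨y, rfl⟩ := hV r hr x
    exact ⟨H.mkQ y, (map_smul _ _ _).symm⟩
  -- Modulo `H`, the map `f` kills `ker d`, and `C ⧸ ker d` embeds in `C'`. Injectivity extends the
  -- induced map to `C'`, and projectivity of `C'` then lifts it to `V`.
  let f' : C ⧸ LinearMap.ker d →ₗ[R] V ⧸ H :=
    (LinearMap.ker d).liftQ (H.mkQ ∘ₗ f) fun c hc => by simpa using hf c hc
  obtain ⟨φ, hφ⟩ := hQ.extension_property ((LinearMap.ker d).liftQ d le_rfl)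
    (LinearMap.ker_eq_bot.1 (Submodule.ker_liftQ_eq_bot _ _ _ le_rfl)) f'
  obtain ⟨G, hG⟩ := Module.projective_lifting_property H.mkQ φ H.mkQ_surjective
  refine ⟨G, fun c => ?_⟩
  have h1 : φ (d c) = H.mkQ (f c) := LinearMap.congr_fun hφ ((LinearMap.ker d).mkQ c)
  have h2 : H.mkQ (G (d c)) = φ (d c) := LinearMap.congr_fun hG (d c)
  rw [← Submodule.Quotient.mk_eq_zero, ← Submodule.mkQ_apply, map_sub, h2, h1, sub_self]

end Divisible

/-- The exterior algebra of a free module is free. -/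
theorem ExteriorAlgebra.free {R : Type u} [CommRing R] (I : Type v) :
    Module.Free R (ExteriorAlgebra R (I →₀ R)) := by
  classical
  let _ : LinearOrder I := linearOrderOfSTO WellOrderingRel
  exact Module.Free.of_basis (Finsupp.basisSingleOne (R := R) (ι := I)).ExteriorAlgebra

/-- A free algebra over a domain embeds into a divisible algebra. -/
theorem exists_divisible_algebra (R : Type u) [CommRing R] [IsDomain R] (S : Type v) [Ring S]
    [Algebra R S] [Module.Free R S] :
    ∃ (V : Type (max u v)) (_ : Ring V) (_ : Algebra R V) (e : S →ₐ[R] V), Function.Injective e ∧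
      ∀ r : R, r ≠ 0 → ∀ x : V, ∃ y : V, r • y = x := by
  -- Freeness of `S` keeps `R → FractionRing R` injective after tensoring with `S`.
  refine ⟨TensorProduct R (FractionRing R) S, inferInstance, inferInstance,
    Algebra.TensorProduct.includeRight,
    Algebra.TensorProduct.includeRight_injective (IsFractionRing.injective R (FractionRing R)),
    fun r hr x => ⟨(algebraMap R (FractionRing R) r)⁻¹ • x, ?_⟩⟩
  rw [← algebraMap_smul (FractionRing R) r, smul_smul, mul_inv_cancel₀, one_smul]
  simpa using hr

/-! ### Cross products and pairings of chains -/

namespace PrecubicalSet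

section Differential

variable (R : Type w) [CommRing R]

/-- The boundary operator `C_n(P) → C_{n-1}(P)`, indexed by the dimension of the source; it is zero
for `n = 0`. -/
noncomputable def differential (P : PrecubicalSet.{u}) (n : ℕ) :
    P.Chain R n →ₗ[R] P.Chain R (n - 1) :=
  Finsupp.linearCombination R fun x : P.cube n =>
    ∑ i : Fin n, (-1 : R) ^ (i.val + 1) •
      (Finsupp.single (P.face' 0 i x) (1 : R) - Finsupp.single (P.face' 1 i x) (1 : R))

theorem differential_zero (P : PrecubicalSet.{u}) : P.differential R 0 = 0 := by
  ext x : 2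
  simp [differential]

theorem differential_succ (P : PrecubicalSet.{u}) (n : ℕ) :
    P.differential R (n + 1) = P.boundary R n := rfl

/-- In degree `0` the truncated index makes the differential an endomorphism of `C_0`, namely zero.
Indexing by the source thus removes the special case in the definition of cycles. -/
theorem cycles_eq_ker (P : PrecubicalSet.{u}) (n : ℕ) :
    P.cycles R n = LinearMap.ker (P.differential R n) := by
  cases n with
  | zero => rw [differential_zero, LinearMap.ker_zero]; rfl
  | succ n => rfl

theorem differential_mem_cycles (P : PrecubicalSet.{u}) {n : ℕ} (c : P.Chain R n) :
    P.differential R n c ∈ P.cycles R (n - 1) := by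
  cases n with
  | zero => exact Submodule.mem_top
  | succ n => exact P.boundaries_le_cycles R n ⟨c, rfl⟩

variable {P : PrecubicalSet.{u₁}} {Q : PrecubicalSet.{u₂}}

/-- The cube `(x, y)` of the tensor product. -/
def tensorMk {n p q : ℕ} (h : p + q = n) (x : P.cube p) (y : Q.cube q) : (P.tensor Q).cube n :=
  (⟨p, q, h, x, y⟩ : TensorCube P Q n)

theorem exists_eq_tensorMk {n : ℕ} (z : (P.tensor Q).cube n) :
    ∃ (p q : ℕ) (h : p + q = n) (x : P.cube p) (y : Q.cube q), z = tensorMk h x y :=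
  ⟨z.p, z.q, z.add_eq, z.fst, z.snd, rfl⟩

theorem tensor_face'_of_lt {n : ℕ} (k : Fin 2) (i : ℕ) (hi : i < n) {p q : ℕ} (h : p + q = n)
    (x : P.cube p) (y : Q.cube q) (hip : i < p) :
    (P.tensor Q).face' k ⟨i, hi⟩ (tensorMk h x y) =
      tensorMk (by omega) (P.face' k ⟨i, hip⟩ x) y := by
  obtain ⟨n, rfl⟩ : ∃ m, n = m + 1 := ⟨n - 1, by omega⟩
  exact tensorFace_of_lt k i hi h x y hip

theorem tensor_face'_of_le {n : ℕ} (k : Fin 2) (i : ℕ) (hi : i < n) {p q : ℕ} (h : p + q = n)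
    (x : P.cube p) (y : Q.cube q) (hip : p ≤ i) :
    (P.tensor Q).face' k ⟨i, hi⟩ (tensorMk h x y) =
      tensorMk (by omega) x (Q.face' k ⟨i - p, by omega⟩ y) := by
  obtain ⟨n, rfl⟩ : ∃ m, n = m + 1 := ⟨n - 1, by omega⟩
  exact tensorFace_of_le k i hi h x y hip

/-- The cube `(x, y)` as an `n`-chain of the tensor product; it is zero if `n` is not the
dimension of `(x, y)`. -/
noncomputable def tensorCubeChain (n : ℕ) {p q : ℕ} (x : P.cube p) (y : Q.cube q) :
    (P.tensor Q).Chain R n :=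
  if h : p + q = n then Finsupp.single (tensorMk h x y) (1 : R) else 0

theorem tensorCubeChain_of_eq {n p q : ℕ} (h : p + q = n) (x : P.cube p) (y : Q.cube q) :
    tensorCubeChain R n x y = Finsupp.single (tensorMk h x y) (1 : R) :=
  dif_pos h

/-- The cross product of chains, with values in the `n`-chains of the tensor product; it is zero
unless `p + q = n`. -/
noncomputable def cross (n p q : ℕ) :
    P.Chain R p →ₗ[R] Q.Chain R q →ₗ[R] (P.tensor Q).Chain R n :=
  Finsupp.linearCombination R fun x => Finsupp.linearCombination R fun y =>
    tensorCubeChain R n x y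

@[simp]
theorem cross_single_single (n : ℕ) {p q : ℕ} (x : P.cube p) (y : Q.cube q) :
    cross R n p q (Finsupp.single x 1) (Finsupp.single y 1) = tensorCubeChain R n x y := by
  simp [cross]

theorem differential_single (P : PrecubicalSet.{u}) {n : ℕ} (x : P.cube n) :
    P.differential R n (Finsupp.single x 1) = ∑ i : Fin n, (-1 : R) ^ (i.val + 1) •
      (Finsupp.single (P.face' 0 i x) (1 : R) - Finsupp.single (P.face' 1 i x) (1 : R)) := by
  simp [differential]

/-- The Leibniz rule for the cross product. -/
theorem differential_cross {n p q : ℕ} (h : p + q = n) (a : P.Chain R p) (b : Q.Chain R q) :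
    (P.tensor Q).differential R n (cross R n p q a b) =
      cross R (n - 1) (p - 1) q (P.differential R p a) b +
        (-1 : R) ^ p • cross R (n - 1) p (q - 1) a (Q.differential R q b) := by
  suffices H : (cross R n p q).compr₂ ((P.tensor Q).differential R n) =
      (cross R (n - 1) (p - 1) q) ∘ₗ P.differential R p +
        (-1 : R) ^ p • (cross R (n - 1) p (q - 1)).compl₂ (Q.differential R q) from
    LinearMap.congr_fun₂ H a b
  ext x y : 4
  subst h
  simp only [LinearMap.comp_apply, Finsupp.lsingle_apply, LinearMap.compr₂_apply,
    LinearMap.add_apply, LinearMap.smul_apply, LinearMap.compl₂_apply, cross_single_single,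
    tensorCubeChain_of_eq R rfl]
  rw [differential_single, differential_single, differential_single, Fin.sum_univ_add]
  simp only [map_sum, map_smul, map_sub, LinearMap.sum_apply, LinearMap.smul_apply,
    LinearMap.sub_apply, cross_single_single, Finset.smul_sum]
  congr 1
  · refine Finset.sum_congr rfl fun i _ => ?_
    have hi := i.isLt
    -- A direction `i : Fin p` exists, so `p > 0` and the subtraction is not truncated.
    have h1 : p - 1 + q = p + q - 1 := by omega
    rw [tensorCubeChain_of_eq R h1, tensorCubeChain_of_eq R h1]
    have h2 := fun k => tensor_face'_of_lt (P := P) (Q := Q) k i.val (by omega) rfl x y hi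
    exact congrArg₂ (fun s t => (-1 : R) ^ (i.val + 1) • (Finsupp.single s (1 : R) -
      Finsupp.single t (1 : R))) (h2 0) (h2 1)
  · refine Finset.sum_congr rfl fun i _ => ?_
    have hi := i.isLt
    have h1 : p + (q - 1) = p + q - 1 := by omega
    rw [tensorCubeChain_of_eq R h1, tensorCubeChain_of_eq R h1, smul_smul, ← pow_add, ← add_assoc]
    have h2 := fun k => tensor_face'_of_le (P := P) (Q := Q) k (p + i.val) (by omega) rfl x y
      (by omega)
    simp only [Nat.add_sub_cancel_left] at h2
    exact congrArg₂ (fun s t => (-1 : R) ^ (p + i.val + 1) • (Finsupp.single s (1 : R) -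
      Finsupp.single t (1 : R))) (h2 0) (h2 1)

theorem cross_mem_cycles {n p q : ℕ} (h : p + q = n) {a : P.Chain R p} {b : Q.Chain R q}
    (ha : a ∈ P.cycles R p) (hb : b ∈ Q.cycles R q) :
    cross R n p q a b ∈ (P.tensor Q).cycles R n := by
  rw [cycles_eq_ker, LinearMap.mem_ker] at *
  rw [differential_cross R h, ha, hb]
  simp

/-- The linear map on chains of the tensor product with `(x, y) ↦ f x * g y`. -/
noncomputable def pairing {V : Type v} [Ring V] [Algebra R V]
    (f : ∀ p, P.Chain R p →ₗ[R] V) (g : ∀ q, Q.Chain R q →ₗ[R] V) (n : ℕ) :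
    (P.tensor Q).Chain R n →ₗ[R] V :=
  Finsupp.linearCombination R fun z : (P.tensor Q).cube n =>
    f z.p (Finsupp.single z.fst 1) * g z.q (Finsupp.single z.snd 1)

theorem pairing_single_tensorMk {V : Type v} [Ring V] [Algebra R V]
    (f : ∀ p, P.Chain R p →ₗ[R] V) (g : ∀ q, Q.Chain R q →ₗ[R] V) {n p q : ℕ} (h : p + q = n)
    (x : P.cube p) (y : Q.cube q) :
    pairing R f g n (Finsupp.single (tensorMk h x y) 1) =
      f p (Finsupp.single x 1) * g q (Finsupp.single y 1) :=
  (Finsupp.linearCombination_single R 1 (tensorMk h x y)).trans (one_smul R _)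

theorem pairing_cross {V : Type v} [Ring V] [Algebra R V]
    (f : ∀ p, P.Chain R p →ₗ[R] V) (g : ∀ q, Q.Chain R q →ₗ[R] V) {n p q : ℕ} (h : p + q = n)
    (a : P.Chain R p) (b : Q.Chain R q) :
    pairing R f g n (cross R n p q a b) = f p a * g q b := by
  suffices H : (cross R n p q).compr₂ (pairing R f g n) =
      (LinearMap.mul R V).compl₁₂ (f p) (g q) from LinearMap.congr_fun₂ H a b
  ext x y : 4
  simp only [LinearMap.comp_apply, Finsupp.lsingle_apply, LinearMap.compr₂_apply,
    LinearMap.compl₁₂_apply, cross_single_single, tensorCubeChain_of_eq R h,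
    pairing_single_tensorMk, LinearMap.mul_apply']

/-- If `f` and `g` are changed to `f - G ∘ d` and `g - K ∘ d`, and these and `g` vanish on
boundaries, then the pairings agree on cycles. -/
theorem pairing_sub_comp_differential {V : Type v} [Ring V] [Algebra R V]
    (f G : ∀ p, P.Chain R p →ₗ[R] V) (g K : ∀ q, Q.Chain R q →ₗ[R] V)
    (hf : ∀ p c, f (p - 1) (P.differential R p c) = 0)
    (hg : ∀ q c, g (q - 1) (Q.differential R q c) = 0)
    {n : ℕ} {z : (P.tensor Q).Chain R n} (hz : z ∈ (P.tensor Q).cycles R n) :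
    pairing R f g n z =
      pairing R (fun p => f p - G (p - 1) ∘ₗ P.differential R p)
        (fun q => g q - K (q - 1) ∘ₗ Q.differential R q) n z := by
  set f' : ∀ p, P.Chain R p →ₗ[R] V := fun p => f p - G (p - 1) ∘ₗ P.differential R p with hf'
  have hdd : ∀ p c, P.differential R (p - 1) (P.differential R p c) = 0 := fun p c => by
    have := P.differential_mem_cycles R c
    rwa [cycles_eq_ker] at this
  have hf'd : ∀ p c, f' (p - 1) (P.differential R p c) = 0 := fun p c => by
    simp [hf', hf, hdd]
  -- This is `f ⊗ g - f' ⊗ g' = (G ∘ d) ⊗ g + f' ⊗ (K ∘ d)`. The Leibniz rule pulls `d` out because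
  -- `g` and `f'` vanish on boundaries.
  have key : pairing R f g n - pairing R f' (fun q => g q - K (q - 1) ∘ₗ Q.differential R q) n =
      (pairing R G g (n - 1) + pairing R (fun p => (-1 : R) ^ p • f' p) K (n - 1)) ∘ₗ
        (P.tensor Q).differential R n := by
    refine Finsupp.lhom_ext' fun z => LinearMap.ext_ring ?_
    obtain ⟨p, q, h, x, y, rfl⟩ := exists_eq_tensorMk z
    simp only [LinearMap.comp_apply, Finsupp.lsingle_apply]
    rw [← tensorCubeChain_of_eq R h, ← cross_single_single, LinearMap.sub_apply,
      pairing_cross R _ _ h, pairing_cross R _ _ h, differential_cross R h]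
    set a : P.Chain R p := Finsupp.single x 1
    set b : Q.Chain R q := Finsupp.single y 1
    have h1 : ∀ F H, pairing R F H (n - 1) (cross R (n - 1) (p - 1) q (P.differential R p a) b) =
        (F (p - 1) (P.differential R p a) * H q b : V) := fun F H => by
      -- For `p = 0` the degrees need not add up to `n - 1`, but then both sides vanish with the
      -- differential.
      rcases Nat.eq_zero_or_pos p with rfl | hp
      · simp [differential_zero]
      · exact pairing_cross R _ _ (by omega) _ _
    have h2 : ∀ F H, pairing R F H (n - 1) (cross R (n - 1) p (q - 1) a (Q.differential R q b)) =
        (F p a * H (q - 1) (Q.differential R q b) : V) := fun F H => by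
      rcases Nat.eq_zero_or_pos q with rfl | hq
      · simp [differential_zero]
      · exact pairing_cross R _ _ (by omega) _ _
    -- The sign put on `f'` cancels the one in the Leibniz rule.
    have h3 : (-1 : R) ^ p * (-1 : R) ^ p = 1 := by rw [← mul_pow]; simp
    simp only [LinearMap.add_apply, map_add, map_smul, h1, h2, hg, LinearMap.smul_apply, hf'd,
      smul_zero, zero_mul, mul_zero, add_zero, zero_add, smul_mul_assoc, smul_smul, h3, one_smul]
    simp only [hf', LinearMap.sub_apply, LinearMap.comp_apply]
    noncomm_ring
  rw [cycles_eq_ker, LinearMap.mem_ker] at hz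
  rw [← sub_eq_zero, ← LinearMap.sub_apply, key, LinearMap.comp_apply, hz, map_zero]

end Differential

end PrecubicalSet

/-! ### Starting edges and labels in a tensor product -/

namespace PrecubicalSet

/-- With this lemma and the next, the recursion for starting edges applies in any dimension `n`, in
particular `p + q`, without first rewriting it as `m + 2`. -/
theorem startEdge_of_lt (P : PrecubicalSet.{u}) {n : ℕ} {i k : ℕ} (hk : k + 1 = n) (hik : i < k)
    (x : P.cube n) :
    P.startEdge ⟨i, by omega⟩ x =
      P.startEdge (n := n - 1) ⟨i, by omega⟩ (P.face' 0 ⟨k, by omega⟩ x) := by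
  obtain ⟨m, rfl⟩ : ∃ m, n = m + 2 := ⟨n - 2, by omega⟩
  obtain rfl : k = m + 1 := by omega
  rw [startEdge, dif_pos hik]
  rfl

theorem startEdge_last (P : PrecubicalSet.{u}) {n : ℕ} {i k : ℕ} (hi : i + 1 = n) (hk : k + 1 = i)
    (x : P.cube n) :
    P.startEdge ⟨i, by omega⟩ x =
      P.startEdge (n := n - 1) ⟨k, by omega⟩ (P.face' 0 ⟨k, by omega⟩ x) := by
  obtain ⟨m, rfl⟩ : ∃ m, n = m + 2 := ⟨n - 2, by omega⟩
  obtain rfl : k = m := by omega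
  rw [startEdge, dif_neg (by simp only; omega)]
  rfl

end PrecubicalSet

open PrecubicalSet

namespace HDA

section Label

variable {A : HDA.{u₁, v₁}} {B : HDA.{u₂, v₂}}

/-- The starting edges of `(x, y)` in a direction of `x` have the labels of starting edges
of `x`, and those in a direction of `y` have the labels of starting edges of `y`. -/
theorem label_startEdge_tensorMk {n : ℕ} : ∀ {p q : ℕ} (h : p + q = n) (x : A.cubes.cube p)
    (y : B.cubes.cube q),
    (∀ (i : ℕ) (hi : i < n) (hip : i < p),
      (A.tensor B).label ((A.tensor B).cubes.startEdge ⟨i, hi⟩ (tensorMk h x y)) =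
        (A.label (A.cubes.startEdge ⟨i, hip⟩ x)).map Sum.inl) ∧
    (∀ (i j : ℕ) (hi : i < n) (hj : j < q), p + j = i →
      (A.tensor B).label ((A.tensor B).cubes.startEdge ⟨i, hi⟩ (tensorMk h x y)) =
        (B.label (B.cubes.startEdge ⟨j, hj⟩ y)).map Sum.inr) := by
  induction n using Nat.strong_induction_on with | _ n ih => ?_
  intro p q h x y
  have face_lt := fun (i : ℕ) (hi : i < n) (hip : i < p) =>
    tensor_face'_of_lt (P := A.cubes) (Q := B.cubes) 0 i hi h x y hip
  have face_le := fun (i : ℕ) (hi : i < n) (hip : p ≤ i) =>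
    tensor_face'_of_le (P := A.cubes) (Q := B.cubes) 0 i hi h x y hip
  rcases Nat.lt_or_ge 1 n with hn | hn
  -- The recursion removes the last direction other than `i`. If it belongs to the same factor as
  -- `i`, the recursion advances in that factor; otherwise that factor is untouched.
  · replace ih := fun {p q : ℕ} => @ih (n - 1) (by omega) p q
    constructor
    · intro i hi hip
      rcases Nat.lt_or_ge i (n - 1) with hi' | hi'
      · refine (congrArg (A.tensor B).label
          (startEdge_of_lt _ (k := n - 1) (by omega) hi' _)).trans ?_
        rcases Nat.eq_zero_or_pos q with hq | hq
        · refine (congrArg (fun z => (A.tensor B).label ((A.tensor B).cubes.startEdge _ z))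
            (face_lt (n - 1) (by omega) (by omega))).trans ?_
          rw [startEdge_of_lt _ (k := n - 1) (by omega) hi' x]
          exact (ih _ _ _).1 i (by omega) (by omega)
        · refine (congrArg (fun z => (A.tensor B).label ((A.tensor B).cubes.startEdge _ z))
            (face_le (n - 1) (by omega) (by omega))).trans ?_
          exact (ih _ _ _).1 i (by omega) (by omega)
      · refine (congrArg (A.tensor B).label
          (startEdge_last _ (k := n - 2) (by omega) (by omega) _)).trans ?_
        refine (congrArg (fun z => (A.tensor B).label ((A.tensor B).cubes.startEdge _ z))
          (face_lt (n - 2) (by omega) (by omega))).trans ?_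
        rw [startEdge_last _ (k := n - 2) (by omega) (by omega) x]
        exact (ih _ _ _).1 _ (by omega) (by omega)
    · intro i j hi hj hij
      rcases Nat.lt_or_ge i (n - 1) with hi' | hi'
      · refine (congrArg (A.tensor B).label
          (startEdge_of_lt _ (k := n - 1) (by omega) hi' _)).trans ?_
        refine (congrArg (fun z => (A.tensor B).label ((A.tensor B).cubes.startEdge _ z))
          (face_le (n - 1) (by omega) (by omega))).trans ?_
        rw [startEdge_of_lt _ (k := n - 1 - p) (by omega) (by omega) y]
        exact (ih _ _ _).2 i j (by omega) (by omega) hij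
      · refine (congrArg (A.tensor B).label
          (startEdge_last _ (k := n - 2) (by omega) (by omega) _)).trans ?_
        -- Here `i` is the last direction, so direction `n - 2` is removed. It belongs to `y`
        -- exactly when `q > 1`; for `q = 1` it is the last direction of `x`.
        rcases Nat.lt_or_ge 1 q with hq | hq
        · refine (congrArg (fun z => (A.tensor B).label ((A.tensor B).cubes.startEdge _ z))
            (face_le (n - 2) (by omega) (by omega))).trans ?_
          rw [startEdge_last _ (k := n - 2 - p) (by omega) (by omega) y]
          exact (ih _ _ _).2 _ _ (by omega) (by omega) (by omega)
        · refine (congrArg (fun z => (A.tensor B).label ((A.tensor B).cubes.startEdge _ z))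
            (face_lt (n - 2) (by omega) (by omega))).trans ?_
          exact (ih _ _ _).2 _ _ (by omega) (by omega) (by omega)
  · rcases (by omega : n = 0 ∨ (n = 1 ∧ p = 1 ∧ q = 0) ∨ (n = 1 ∧ p = 0 ∧ q = 1)) with
      rfl | ⟨rfl, rfl, rfl⟩ | ⟨rfl, rfl, rfl⟩
    · exact ⟨fun i hi => absurd hi (by omega), fun i j hi => absurd hi (by omega)⟩
    · exact ⟨fun i hi hip => rfl, fun i j hi hj => absurd hj (by omega)⟩
    · exact ⟨fun i hi hip => absurd hip (by omega), fun i j hi hj hij => by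
        obtain rfl : j = 0 := by omega
        rfl⟩

variable (R : Type w) [CommRing R]

/-- The labeling chain map with values in the exterior algebra. -/
noncomputable def labelLinear (A : HDA.{u, v}) (n : ℕ) : A.cubes.Chain R n →ₗ[R] A.Ext R :=
  (⋀[R]^n (A.alphabet.letter →₀ R)).subtype ∘ₗ A.labelChain R n

theorem labelLinear_differential (A : HDA.{u, v}) (n : ℕ) (c : A.cubes.Chain R n) :
    A.labelLinear R (n - 1) (A.cubes.differential R n c) = 0 := by
  cases n with
  | zero => rw [differential_zero, LinearMap.zero_apply, map_zero]
  | succ n =>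
    rw [differential_succ]
    exact congrArg (⋀[R]^n (A.alphabet.letter →₀ R)).subtype
      (LinearMap.congr_fun (A.labelChain_boundary R n) c)

/-- The sum of the letters of a word. -/
noncomputable def letterSum {S : Type v} (m : List S) : S →₀ R :=
  ∑ j : Fin m.length, Finsupp.single (m.get j) (1 : R)

theorem letterSum_eq {S : Type v} (m : List S) :
    letterSum R m = (m.map fun a => Finsupp.single a (1 : R)).sum := by
  conv_rhs => rw [← List.ofFn_get m, List.map_ofFn, List.sum_ofFn]
  rfl

theorem letterSum_map {S : Type v} {T : Type v₁} (f : S → T) (m : List S) :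
    letterSum R (m.map f) = Finsupp.lmapDomain R R f (letterSum R m) := by
  simp [letterSum_eq, map_list_sum, Function.comp_def]

/-- Multilinearity collapses the sum over all tuples of letters to one wedge product with a vector
per direction. The label of a product cube then comes from concatenating two families of vectors. -/
theorem labelLinear_single (A : HDA.{u, v}) {n : ℕ} (x : A.cubes.cube n) :
    A.labelLinear R n (Finsupp.single x 1) = ExteriorAlgebra.ιMulti R n fun i =>
      letterSum R (A.label (A.cubes.startEdge i x)) := by
  simp only [labelLinear, labelChain, LinearMap.comp_apply, Finsupp.linearCombination_single,
    one_smul, cubeLabel, Submodule.subtype_apply, letterSum]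
  rw [← exteriorPower.ιMulti_apply_coe]
  congr 1
  exact ((exteriorPower.ιMulti R n (M := A.alphabet.letter →₀ R)).toMultilinearMap.map_sum
    fun i (j : Fin (A.label (A.cubes.startEdge i x)).length) =>
      Finsupp.single ((A.label (A.cubes.startEdge i x)).get j) (1 : R)).symm

/-- The labeling of `(x, y)` is the product of the labelings of `x` and `y`. -/
theorem labelLinear_tensorMk {n p q : ℕ} (h : p + q = n) (x : A.cubes.cube p)
    (y : B.cubes.cube q) :
    (A.tensor B).labelLinear R n (Finsupp.single (tensorMk h x y) 1) =
      A.extInl R B (A.labelLinear R p (Finsupp.single x 1)) *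
        A.extInr R B (B.labelLinear R q (Finsupp.single y 1)) := by
  subst h
  refine (labelLinear_single R (A.tensor B) _).trans ?_
  rw [labelLinear_single, labelLinear_single, extInl, extInr,
    ExteriorAlgebra.map_apply_ιMulti, ExteriorAlgebra.map_apply_ιMulti,
    ExteriorAlgebra.ιMulti_mul_ιMulti]
  congr 1
  funext i
  refine Fin.addCases (fun i => ?_) (fun j => ?_) i
  · rw [Fin.append_left, Function.comp_apply]
    refine Eq.trans (congrArg (letterSum R) ?_) (letterSum_map R _ _)
    exact
      ((label_startEdge_tensorMk rfl x y).1 i.val (by omega) i.isLt)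
  · rw [Fin.append_right, Function.comp_apply]
    refine Eq.trans (congrArg (letterSum R) ?_) (letterSum_map R _ _)
    exact
      ((label_startEdge_tensorMk rfl x y).2 (p + j.val) j.val (by omega) j.isLt rfl)

theorem labelLinear_eq_pairing (n : ℕ) :
    (A.tensor B).labelLinear R n =
      pairing R (fun p => (A.extInl R B).toLinearMap ∘ₗ A.labelLinear R p)
        (fun q => (A.extInr R B).toLinearMap ∘ₗ B.labelLinear R q) n := by
  refine Finsupp.lhom_ext' fun z => LinearMap.ext_ring ?_
  obtain ⟨p, q, h, x, y, rfl⟩ := exists_eq_tensorMk (P := A.cubes) (Q := B.cubes) z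
  refine (labelLinear_tensorMk R h x y).trans ?_
  exact (pairing_single_tensorMk R (fun p => (A.extInl R B).toLinearMap ∘ₗ A.labelLinear R p)
    (fun q => (A.extInr R B).toLinearMap ∘ₗ B.labelLinear R q) h x y).symm

/-- Every class is represented by a cycle, so from here on the language can be computed on cycles,
without the homology quotient. -/
theorem homologyLanguageDeg_eq (A : HDA.{u, v}) (n : ℕ) :
    A.homologyLanguageDeg R n = (A.cubes.cycles R n).map (A.labelLinear R n) := by
  rw [homologyLanguageDeg, labelLinear, Submodule.map_comp]
  congr 1
  ext a
  constructor
  · rintro ⟨c, rfl⟩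
    obtain ⟨z, rfl⟩ := Subquotient.mk_surjective _ _ c
    exact ⟨z, z.2, rfl⟩
  · rintro ⟨z, hz, rfl⟩
    exact ⟨Subquotient.mk _ _ ⟨z, hz⟩, rfl⟩

theorem homologyLanguage_eq_iSup (A : HDA.{u, v}) :
    A.homologyLanguage R = ⨆ n, A.homologyLanguageDeg R n := by
  classical
  rw [homologyLanguage, LinearMap.range_eq_map, ← DFinsupp.iSup_range_lsingle, Submodule.map_iSup]
  refine iSup_congr fun n => ?_
  rw [homologyLanguageDeg, ← LinearMap.range_comp, ← LinearMap.range_comp]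
  congr 1
  ext c
  exact DirectSum.toModule_lof R n c

end Label

end HDA

/-! ### The homology language of a tensor product -/

namespace HDA

section Tensor

variable {R : Type w} [CommRing R] {A : HDA.{u₁, v₁}} {B : HDA.{u₂, v₂}}

/-- A labeling on chains with values in a divisible module can be corrected by a map that factors
through the differential to take values in the homology language. -/
theorem exists_sub_differential_mem [IsDomain R] [IsPrincipalIdealRing R] {V : Type v}
    [AddCommGroup V] [Module R V] (hV : ∀ r : R, r ≠ 0 → ∀ x : V, ∃ y : V, r • y = x)
    (A : HDA.{u₁, v₁}) (φ : A.Ext R →ₗ[R] V) :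
    ∃ G : ∀ p, A.cubes.Chain R p →ₗ[R] V, ∀ p c,
      φ (A.labelLinear R p c) - G (p - 1) (A.cubes.differential R p c) ∈
        (A.homologyLanguageDeg R p).map φ := by
  have hmem : ∀ p c, c ∈ A.cubes.cycles R p →
      φ (A.labelLinear R p c) ∈ (A.homologyLanguageDeg R p).map φ := fun p c hc =>
    Submodule.mem_map_of_mem (homologyLanguageDeg_eq R A p ▸ Submodule.mem_map_of_mem hc)
  choose G hG using fun p => LinearMap.exists_sub_comp_mem hV (A.cubes.boundary R p)
    (φ ∘ₗ A.labelLinear R (p + 1)) ((A.homologyLanguageDeg R (p + 1)).map φ)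
    fun c hc => hmem (p + 1) c hc
  refine ⟨G, fun p c => ?_⟩
  cases p with
  | zero =>
    -- Every `0`-chain is a cycle, so no correction is needed in degree `0`.
    rw [differential_zero, LinearMap.zero_apply, map_zero, sub_zero]
    exact hmem 0 c Submodule.mem_top
  | succ p => exact hG p c

/-- The cross product of cycles representing the two factors is a cycle whose label is their
product. -/
theorem mul_le_homologyLanguageDeg_tensor {n p q : ℕ} (h : p + q = n) :
    (A.homologyLanguageDeg R p).map (A.extInl R B).toLinearMap *
      (B.homologyLanguageDeg R q).map (A.extInr R B).toLinearMap ≤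
        (A.tensor B).homologyLanguageDeg R n := by
  rw [homologyLanguageDeg_eq, homologyLanguageDeg_eq, homologyLanguageDeg_eq, Submodule.mul_le]
  rintro _ ⟨_, ⟨a, ha, rfl⟩, rfl⟩ _ ⟨_, ⟨b, hb, rfl⟩, rfl⟩
  refine ⟨cross R n p q a b, cross_mem_cycles R h ha hb, ?_⟩
  rw [labelLinear_eq_pairing]
  exact pairing_cross R _ _ h a b

/-- A pairing of maps with values in submodules takes values in the sum of their products. -/
theorem pairing_mem {P : PrecubicalSet.{u₁}} {Q : PrecubicalSet.{u₂}} {V : Type v} [Ring V]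
    [Algebra R V] {f : ∀ p, P.Chain R p →ₗ[R] V} {g : ∀ q, Q.Chain R q →ₗ[R] V}
    {H K : ℕ → Submodule R V} (hf : ∀ p c, f p c ∈ H p) (hg : ∀ q c, g q c ∈ K q) (n : ℕ)
    (z : (P.tensor Q).Chain R n) :
    pairing R f g n z ∈ ⨆ (p : ℕ) (q : ℕ) (_ : p + q = n), H p * K q := by
  rw [pairing, Finsupp.linearCombination_apply]
  refine Submodule.sum_mem _ fun c _ => Submodule.smul_mem _ _ ?_
  exact Submodule.mem_iSup_of_mem c.p <| Submodule.mem_iSup_of_mem c.q <|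
    Submodule.mem_iSup_of_mem c.add_eq <| Submodule.mul_mem_mul (hf _ _) (hg _ _)

/-- The corrections of the two labelings exist only after passing to the divisible algebra `V`. They
do not change the label of a cycle, but make each term of its expansion into cubes a product of
elements of the two languages. -/
theorem homologyLanguageDeg_tensor_le [IsDomain R] [IsPrincipalIdealRing R] (n : ℕ) :
    (A.tensor B).homologyLanguageDeg R n ≤ ⨆ (p : ℕ) (q : ℕ) (_ : p + q = n),
      (A.homologyLanguageDeg R p).map (A.extInl R B).toLinearMap *
        (B.homologyLanguageDeg R q).map (A.extInr R B).toLinearMap := by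
  have : Module.Free R ((A.tensor B).Ext R) := ExteriorAlgebra.free _
  obtain ⟨V, _, _, e, he, hV⟩ := exists_divisible_algebra R ((A.tensor B).Ext R)
  let φ : A.Ext R →ₗ[R] V := (e.comp (A.extInl R B)).toLinearMap
  let ψ : B.Ext R →ₗ[R] V := (e.comp (A.extInr R B)).toLinearMap
  obtain ⟨G, hG⟩ := exists_sub_differential_mem hV A φ
  obtain ⟨K, hK⟩ := exists_sub_differential_mem hV B ψ
  rw [homologyLanguageDeg_eq]
  rintro _ ⟨z, hz, rfl⟩
  have h1 : e ((A.tensor B).labelLinear R n z) =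
      pairing R (fun p => φ ∘ₗ A.labelLinear R p) (fun q => ψ ∘ₗ B.labelLinear R q) n z := by
    rw [labelLinear_eq_pairing]
    refine LinearMap.congr_fun (f := e.toLinearMap ∘ₗ pairing R _ _ n) ?_ z
    refine Finsupp.lhom_ext' fun c => LinearMap.ext_ring ?_
    simp [pairing, φ, ψ]
  have h2 := pairing_sub_comp_differential R (fun p => φ ∘ₗ A.labelLinear R p) G
    (fun q => ψ ∘ₗ B.labelLinear R q) K
    (fun p c => by simp [labelLinear_differential]) (fun q c => by simp [labelLinear_differential])
    hz
  have h3 : e ((A.tensor B).labelLinear R n z) ∈ ⨆ (p : ℕ) (q : ℕ) (_ : p + q = n),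
      (A.homologyLanguageDeg R p).map φ * (B.homologyLanguageDeg R q).map ψ := by
    rw [h1, h2]
    exact pairing_mem (fun p c => hG p c) (fun q c => hK q c) n z
  -- Since `e` is an algebra map, the sum of products in `V` is the image of the sum in the exterior
  -- algebra; its injectivity then allows membership to be pulled back.
  have h4 : (⨆ (p : ℕ) (q : ℕ) (_ : p + q = n),
      (A.homologyLanguageDeg R p).map φ * (B.homologyLanguageDeg R q).map ψ) =
      (⨆ (p : ℕ) (q : ℕ) (_ : p + q = n),
        (A.homologyLanguageDeg R p).map (A.extInl R B).toLinearMap *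
        (B.homologyLanguageDeg R q).map (A.extInr R B).toLinearMap).map e.toLinearMap := by
    simp only [Submodule.map_iSup, Submodule.map_mul, ← Submodule.map_comp]
    rfl
  rw [h4] at h3
  obtain ⟨y, hy, hye⟩ := h3
  exact he hye ▸ hy

end Tensor

end HDA

theorem mainTheorem8 (R : Type w) [CommRing R] [IsDomain R] [IsPrincipalIdealRing R]
    (A : HDA.{u₁, v₁}) (B : HDA.{u₂, v₂}) :
    (A.tensor B).homologyLanguage R =
        (A.homologyLanguage R).map (A.extInl R B).toLinearMap *
          (B.homologyLanguage R).map (A.extInr R B).toLinearMap ∧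
      ∀ n : ℕ, (A.tensor B).homologyLanguageDeg R n =
        ⨆ (p : ℕ) (q : ℕ) (_ : p + q = n),
          (A.homologyLanguageDeg R p).map (A.extInl R B).toLinearMap *
            (B.homologyLanguageDeg R q).map (A.extInr R B).toLinearMap := by
  have hdeg : ∀ n : ℕ, (A.tensor B).homologyLanguageDeg R n =
      ⨆ (p : ℕ) (q : ℕ) (_ : p + q = n),
        (A.homologyLanguageDeg R p).map (A.extInl R B).toLinearMap *
          (B.homologyLanguageDeg R q).map (A.extInr R B).toLinearMap := fun n =>
    le_antisymm (HDA.homologyLanguageDeg_tensor_le n)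
      (iSup_le fun _ => iSup_le fun _ => iSup_le fun h => HDA.mul_le_homologyLanguageDeg_tensor h)
  refine ⟨?_, hdeg⟩
  simp only [HDA.homologyLanguage_eq_iSup, hdeg, Submodule.map_iSup, Submodule.iSup_mul,
    Submodule.mul_iSup]
  -- The supremum over `n` is moved innermost, where `p + q = n` determines `n`.
  conv_rhs => rw [iSup_comm]
  rw [iSup_comm]
  refine iSup_congr fun p => ?_
  rw [iSup_comm]
  exact iSup_congr fun q => iSup_iSup_eq_right
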